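/- Let $k \ge 3$ be an integer with $k \ne 4, 8$, and write $q^x := e^{2\pi i x/(k+2)}$ for real $x$. In the anyon model $\mathbf{SU}(2)_k$ the anyon types are the half-integers $0, \tfrac12, 1, \dots, \tfrac k2$, and $j$ occurs in $j_1\otimes j_2$ (with multiplicity one) exactly if $|j_1-j_2|\le j\le \min\{j_1+j_2,\,k-j_1-j_2\}$ and $j_1+j_2+j\in\mathbb Z$. Put $[n]_q=\frac{q^{n/2}-q^{-n/2}}{q^{1/2}-q^{-1/2}}$, $[0]_q!=1$, $[n]_q!=[n-1]_q!\,[n]_q$. The $R$-symbols are $$R^{j_1j_2}_j=(-1)^{j-j_1-j_2}\,q^{\frac12\left(j(j+1)-j_1(j_1+1)-j_2(j_2+1)\right)},$$ and the $F$-symbols are $$F^{j_1j_2j_3}_{j;\,j_{23}\,j_{12}}=(-1)^{j_1+j_2+j_3+j}\sqrt{[2j_{12}+1]_q[2j_{23}+1]_q}\;\begin{Bmatrix} j_1&j_2&j_{12}\\ j_3&j&j_{23}\end{Bmatrix}_q ,$$ where $$\begin{Bmatrix} j_1&j_2&j_{12}\\ j_3&j&j_{23}\end{Bmatrix}_q=\Delta(j_1,j_2,j_{12})\,\Delta(j_{12},j_3,j)\,\Delta(j_2,j_3,j_{23})\,\Delta(j_1,j_{23},j)\sum_z\frac{(-1)^z[z+1]_q!}{P_z\,Q_z},$$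 $$P_z=[z-j_1-j_2-j_{12}]_q!\,[z-j_{12}-j_3-j]_q!\,[z-j_2-j_3-j_{23}]_q!\,[z-j_1-j_{23}-j]_q!,$$ $$Q_z=[j_1+j_2+j_3+j-z]_q!\,[j_1+j_{12}+j_3+j_{23}-z]_q!\,[j_2+j_{12}+j+j_{23}-z]_q!,$$ $$\Delta(a,b,c)=\sqrt{\frac{[-a+b+c]_q!\,[a-b+c]_q!\,[a+b-c]_q!}{[a+b+c+1]_q!}},$$ and $z$ runs over the integers for which all arguments of the quantum factorials are non-negative. Let $\tau=\tfrac12$. The one-qubit space $V^{\tau\tau\tau}_\tau$ of three $\tau$ anyons with total type $\tau$ is the two-dimensional Hilbert space with orthonormal basis $|0\rangle,|1\rangle$, where $|x\rangle$ is the splitting tree $((\tau\tau)_x\tau)_\tau$. Let $B_3=\langle\sigma_1,\sigma_2\mid\sigma_1\sigma_2\sigma_1=\sigma_2\sigma_1\sigma_2\rangle$ be the braid group on three strands, and let $\rho_k\colon B_3\to U(V^{\tau\tau\tau}_\tau)$ be the unitary representation given by counterclockwise braiding, that is, $$\rho_k(\sigma_1)=R,\qquad \rho_k(\sigma_2)=F^{-1}RF,$$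 with $R=\operatorname{diag}(R^{\tau\tau}_0,R^{\tau\tau}_1)$ and $F=\big(F^{\tau\tau\tau}_{\tau;\,yx}\big)_{y,x\in\{0,1\}}$ in the basis $|0\rangle,|1\rangle$. Then $\rho_k(\sigma_1^2)$ and $\rho_k(\sigma_2^2)$, together with the global phases $\{c\cdot \mathrm{id} : c\in\mathbb C,\ |c|=1\}$, generate a dense subgroup of the unitary group $U(V^{\tau\tau\tau}_\tau)\cong U(2)$. In other words, double-braidings alone are universal: the image under $\rho_k$ of the subgroup of $B_3$ generated by $\sigma_1^2$ and $\sigma_2^2$, together with the global phases, generates a dense subgroup of $U(V^{\tau\tau\tau}_\tau)$. -/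

import Mathlib

/-! ## The braid group -/

/-- The defining relators of the Artin braid group on `n` strands. The generator `i : Fin (n - 1)`
(counted from `0`) is the standard generator `σ_{i+1}`. -/
def braidRels (n : ℕ) : Set (FreeGroup (Fin (n - 1))) :=
  {r | ∃ i j : Fin (n - 1), (i : ℕ) + 1 = (j : ℕ) ∧
      r = (FreeGroup.of i * FreeGroup.of j * FreeGroup.of i) *
        (FreeGroup.of j * FreeGroup.of i * FreeGroup.of j)⁻¹} ∪
  {r | ∃ i j : Fin (n - 1), (i : ℕ) + 1 < (j : ℕ) ∧
      r = (FreeGroup.of i * FreeGroup.of j) * (FreeGroup.of j * FreeGroup.of i)⁻¹}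

/-- The braid group `B_n` on `n` strands. -/
abbrev BraidGroup (n : ℕ) : Type := PresentedGroup (braidRels n)

/-- The standard generators of the braid group (the index is counted from `0`). -/
def braidSigma {n : ℕ} (i : Fin (n - 1)) : BraidGroup n := PresentedGroup.of i

/-- The group of double-braidings: the subgroup of `B_n` generated by the squares of the standard
generators. -/
def doubleBraidings (n : ℕ) : Subgroup (BraidGroup n) :=
  Subgroup.closure (Set.range fun i : Fin (n - 1) => braidSigma i ^ 2)

theorem lift_braidRels_three {G : Type*} [Group G] (f : Fin 2 → G)
    (h : f 0 * f 1 * f 0 = f 1 * f 0 * f 1) :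
    ∀ r ∈ braidRels 3, FreeGroup.lift f r = 1 := by
  rintro r (⟨i, j, hij, rfl⟩ | ⟨i, j, hij, rfl⟩)
  · obtain rfl : i = (0 : Fin 2) := Fin.ext (by simp; omega)
    obtain rfl : j = (1 : Fin 2) := Fin.ext (by simp at hij ⊢; omega)
    simp only [map_mul, map_inv, FreeGroup.lift_apply_of]
    rw [mul_inv_eq_one, h]
  · omega

/-! ## Universality -/

/-- The global phases `U(1)` inside the unitary group of a Hilbert space. -/
def globalPhases (V : Type*) [NormedAddCommGroup V] [InnerProductSpace ℂ V] [CompleteSpace V] :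
    Set (unitary (V →L[ℂ] V)) :=
  {u | ∃ c : ℂ, ‖c‖ = 1 ∧ (u : V →L[ℂ] V) = c • (1 : V →L[ℂ] V)}

/-- A set of gates is universal if, together with the global phases, it generates a dense
subgroup of the unitary group. -/
def IsUniversalGateSet {V : Type*} [NormedAddCommGroup V] [InnerProductSpace ℂ V]
    [CompleteSpace V] (G : Set (unitary (V →L[ℂ] V))) : Prop :=
  Dense ((Subgroup.closure (G ∪ globalPhases V) : Subgroup (unitary (V →L[ℂ] V))) :
    Set (unitary (V →L[ℂ] V)))

/-! ## The anyon model `SU(2)_k`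

Anyon types are labelled by half-integers `0, 1/2, …, k/2`. Everywhere below, a natural number
`a` used as a label is the *doubled* spin: it stands for the anyon type `a / 2`. -/

namespace SU2k

/-- `q^x = exp (2πi x / (k + 2))`. -/
noncomputable def qPow (k : ℕ) (x : ℝ) : ℂ :=
  Complex.exp (2 * Real.pi * Complex.I * x / (k + 2))

/-- The quantum integer `[n]_q` at `q = exp (2πi / (k + 2))`, as a real number; see `qInt_eq`
for the usual formula in terms of `q`. -/
noncomputable def qInt (k n : ℕ) : ℝ :=
  Real.sin (n * (Real.pi / (k + 2))) / Real.sin (Real.pi / (k + 2))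

/-- The quantum factorial `[n]_q!`. -/
noncomputable def qFact (k : ℕ) : ℕ → ℝ
  | 0 => 1
  | n + 1 => qFact k n * qInt k (n + 1)

/-- The fusion rule of `SU(2)_k`: `c / 2` occurs (with multiplicity one) in `a / 2 ⊗ b / 2`
exactly if `|a - b| / 2 ≤ c / 2 ≤ min ((a + b) / 2, k - (a + b) / 2)` and `(a + b + c) / 2` is an
integer. -/
def Admissible (k a b c : ℕ) : Prop :=
  a ≤ b + c ∧ b ≤ a + c ∧ c ≤ a + b ∧ a + b + c ≤ 2 * k ∧ (a + b + c) % 2 = 0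

instance (k a b c : ℕ) : Decidable (Admissible k a b c) := by
  unfold Admissible; infer_instance

/-- The symbol `R^{a/2, b/2}_{c/2}`. -/
noncomputable def Rsymbol (k a b c : ℕ) : ℂ :=
  (-1 : ℂ) ^ (((c : ℤ) - a - b) / 2) *
    qPow k ((1 / 2) * ((c / 2 : ℝ) * (c / 2 + 1) - (a / 2 : ℝ) * (a / 2 + 1)
      - (b / 2 : ℝ) * (b / 2 + 1)))

/-- The triangle coefficient `Δ(a/2, b/2, c/2)`. -/
noncomputable def triangle (k a b c : ℕ) : ℝ :=
  Real.sqrt (qFact k ((b + c - a) / 2) * qFact k ((a + c - b) / 2) * qFact k ((a + b - c) / 2) /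
    qFact k ((a + b + c) / 2 + 1))

/-- The quantum `6j`-symbol `{a/2 b/2 e/2 ; c/2 d/2 f/2}_q`. The summation range consists of the
`z` for which all arguments of the quantum factorials are non-negative. -/
noncomputable def sixJ (k a b e c d f : ℕ) : ℝ :=
  triangle k a b e * triangle k e c d * triangle k b c f * triangle k a f d *
    ∑ z ∈ Finset.Icc
        (max (max ((a + b + e) / 2) ((e + c + d) / 2)) (max ((b + c + f) / 2) ((a + f + d) / 2)))
        (min ((a + b + c + d) / 2) (min ((a + e + c + f) / 2) ((b + e + d + f) / 2))),
      (-1 : ℝ) ^ z * qFact k (z + 1) /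
        (qFact k (z - (a + b + e) / 2) * qFact k (z - (e + c + d) / 2) *
          qFact k (z - (b + c + f) / 2) * qFact k (z - (a + f + d) / 2) *
          qFact k ((a + b + c + d) / 2 - z) * qFact k ((a + e + c + f) / 2 - z) *
          qFact k ((b + e + d + f) / 2 - z))

/-- The symbol `F^{a/2, b/2, c/2}_{d/2; f/2, e/2}`, where `e` labels the internal edge of the
splitting tree `((a b)_e c)_d` and `f` the internal edge of the splitting tree `(a (b c)_f)_d`. -/
noncomputable def Fsymbol (k a b c d f e : ℕ) : ℝ :=
  (-1 : ℝ) ^ ((a + b + c + d) / 2) * Real.sqrt (qInt k (e + 1) * qInt k (f + 1)) *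
    sixJ k a b e c d f

/-- The labels `m` of the internal edge of the splitting tree `((a a)_m a)_d`. As the fusion rule
is symmetric, they are also the labels of the internal edge of the splitting tree
`(a (a a)_m)_d`. -/
def InternalLabel (k a d : ℕ) : Type :=
  {m : Fin (k + 1) // Admissible k a a m ∧ Admissible k m a d}

instance (k a d : ℕ) : Fintype (InternalLabel k a d) := by
  unfold InternalLabel; infer_instance

instance (k a d : ℕ) : DecidableEq (InternalLabel k a d) := by
  unfold InternalLabel; infer_instance

/-- The underlying doubled spin of the label of an internal edge. -/
def InternalLabel.spin2 {k a d : ℕ} (m : InternalLabel k a d) : ℕ := (m.1 : ℕ)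

/-- The space `V^{aaa}_d` of three anyons of type `a / 2` with total type `d / 2`: the Hilbert
space having the splitting-tree basis `((a a)_m a)_d` as an orthonormal basis. -/
abbrev ThreeAnyonSpace (k a d : ℕ) : Type := EuclideanSpace ℂ (InternalLabel k a d)

/-- The diagonal matrix of `R`-symbols. -/
noncomputable def Rmat (k a d : ℕ) : Matrix (InternalLabel k a d) (InternalLabel k a d) ℂ :=
  Matrix.diagonal fun m => Rsymbol k a a m.spin2

/-- The `F`-matrix `F^{aaa}_d`. -/
noncomputable def Fmat (k a d : ℕ) : Matrix (InternalLabel k a d) (InternalLabel k a d) ℂ :=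
  Matrix.of fun n m => (Fsymbol k a a a d n.spin2 m.spin2 : ℂ)

/-- The matrix, in the splitting-tree basis of `V^{aaa}_d`, of the counterclockwise braiding of
the first two anyons (index `0`) and of the last two anyons (index `1`). -/
noncomputable def braidMat (k a d : ℕ) (i : Fin 2) :
    Matrix (InternalLabel k a d) (InternalLabel k a d) ℂ :=
  if i = 0 then Rmat k a d else (Fmat k a d)⁻¹ * Rmat k a d * Fmat k a d

/-! ### Helper facts: the braiding matrices on `V^{τττ}_τ` are unitary and satisfy the braid
relation -/

theorem sin_pos (k : ℕ) : 0 < Real.sin (Real.pi / (k + 2)) := by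
  have hk : (0 : ℝ) ≤ k := Nat.cast_nonneg k
  apply Real.sin_pos_of_pos_of_lt_pi
  · positivity
  · rw [div_lt_iff₀ (by positivity)]
    nlinarith [Real.pi_pos]

/-- The quantum integers in terms of `q`. -/
theorem qInt_eq (k n : ℕ) :
    (qInt k n : ℂ) =
      (qPow k (n / 2) - qPow k (-(n / 2))) / (qPow k (1 / 2) - qPow k (-(1 / 2))) := by
  have key : ∀ x : ℝ, qPow k (x / 2) - qPow k (-(x / 2)) =
      2 * Complex.I * ((Real.sin (x * (Real.pi / (k + 2))) : ℝ) : ℂ) := by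
    intro x
    have hk : (k : ℂ) + 2 ≠ 0 := by exact_mod_cast (by omega : k + 2 ≠ 0)
    rw [Complex.ofReal_sin, Complex.sin, qPow, qPow]
    have e1 : 2 * (Real.pi : ℂ) * Complex.I * ((x / 2 : ℝ) : ℂ) / (k + 2) =
        ((x * (Real.pi / (k + 2)) : ℝ) : ℂ) * Complex.I := by
      push_cast; field_simp
    have e2 : 2 * (Real.pi : ℂ) * Complex.I * ((-(x / 2) : ℝ) : ℂ) / (k + 2) =
        -((x * (Real.pi / (k + 2)) : ℝ) : ℂ) * Complex.I := by
      push_cast; field_simp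
    rw [e1, e2]
    linear_combination (Complex.exp (((x * (Real.pi / (k + 2)) : ℝ) : ℂ) * Complex.I) -
      Complex.exp (-((x * (Real.pi / (k + 2)) : ℝ) : ℂ) * Complex.I)) * Complex.I_sq
  have h1 := key n
  have h2 := key 1
  rw [h1, h2, one_mul, mul_div_mul_left _ _ (by simp), qInt]
  push_cast
  rfl

theorem qInt_one (k : ℕ) : qInt k 1 = 1 := by
  simp [qInt, (sin_pos k).ne']

theorem qInt_two (k : ℕ) : qInt k 2 = 2 * Real.cos (Real.pi / (k + 2)) := by
  have h := (sin_pos k).ne'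
  rw [qInt, Nat.cast_ofNat, Real.sin_two_mul]
  field_simp

theorem qInt_three (k : ℕ) : qInt k 3 = qInt k 2 ^ 2 - 1 := by
  have h := (sin_pos k).ne'
  rw [qInt_two, qInt, Nat.cast_ofNat, Real.sin_three_mul]
  field_simp
  nlinarith [Real.sin_sq_add_cos_sq (Real.pi / ((k : ℝ) + 2))]

theorem two_le_qInt_two_sq {k : ℕ} (hk : 2 ≤ k) : 0 < qInt k 2 ∧ 2 ≤ qInt k 2 ^ 2 := by
  have hk' : (2 : ℝ) ≤ k := by exact_mod_cast hk
  have h1 : Real.cos (Real.pi / 4) ≤ Real.cos (Real.pi / (k + 2)) := by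
    apply Real.cos_le_cos_of_nonneg_of_le_pi
    · positivity
    · linarith [Real.pi_pos]
    · apply div_le_div_of_nonneg_left Real.pi_pos.le (by norm_num) (by linarith)
  rw [Real.cos_pi_div_four] at h1
  have h2 : Real.sqrt 2 ^ 2 = 2 := Real.sq_sqrt (by norm_num)
  have h3 : 0 < Real.sqrt 2 := by positivity
  rw [qInt_two]
  constructor <;> nlinarith

theorem triangle_zero (k : ℕ) : triangle k 1 1 0 = Real.sqrt (1 / qInt k 2) ∧
    triangle k 1 0 1 = Real.sqrt (1 / qInt k 2) ∧
    triangle k 0 1 1 = Real.sqrt (1 / qInt k 2) := by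
  refine ⟨?_, ?_, ?_⟩ <;> norm_num [triangle, qFact, qInt_one]

theorem triangle_two (k : ℕ) :
    triangle k 1 1 2 = Real.sqrt (1 / (qInt k 2 * qInt k 3)) ∧
    triangle k 1 2 1 = Real.sqrt (1 / (qInt k 2 * qInt k 3)) ∧
    triangle k 2 1 1 = Real.sqrt (1 / (qInt k 2 * qInt k 3)) := by
  refine ⟨?_, ?_, ?_⟩ <;> norm_num [triangle, qFact, qInt_one]

theorem Fsymbol_values {k : ℕ} (hk : 2 ≤ k) :
    Fsymbol k 1 1 1 1 0 0 = -(1 / qInt k 2) ∧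
    Fsymbol k 1 1 1 1 0 2 = Real.sqrt (qInt k 3) / qInt k 2 ∧
    Fsymbol k 1 1 1 1 2 0 = Real.sqrt (qInt k 3) / qInt k 2 ∧
    Fsymbol k 1 1 1 1 2 2 = 1 / qInt k 2 := by
  obtain ⟨h2, h2'⟩ := two_le_qInt_two_sq hk
  have h3 : 0 < qInt k 3 := by rw [qInt_three]; linarith
  have hs := Real.mul_self_sqrt (show (0 : ℝ) ≤ 1 / qInt k 2 by positivity)
  have ht := Real.mul_self_sqrt (show (0 : ℝ) ≤ 1 / (qInt k 2 * qInt k 3) by positivity)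
  have hu := Real.mul_self_sqrt h3.le
  obtain ⟨a1, a2, a3⟩ := triangle_zero k
  obtain ⟨b1, b2, b3⟩ := triangle_two k
  simp only [Fsymbol, sixJ, a1, a2, a3, b1, b2, b3]
  have i1 : Finset.Icc (max (max 1 1) (max 1 1)) (min 2 (min 1 1)) = {1} := by decide
  have i2 : Finset.Icc (max (max 2 2) (max 1 1)) (min 2 (min 2 2)) = {2} := by decide
  have i3 : Finset.Icc (max (max 1 1) (max 2 2)) (min 2 (min 2 2)) = {2} := by decide
  have i4 : Finset.Icc (max (max 2 2) (max 2 2)) (min 2 (min 3 3)) = {2} := by decide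
  norm_num only [qInt_one]
  simp only [i1, i2, i3, i4, Finset.sum_singleton]
  norm_num only [qFact, qInt_one, one_mul, mul_one, Real.sqrt_mul_self h3.le]
  generalize Real.sqrt (1 / qInt k 2) = s at *
  generalize Real.sqrt (1 / (qInt k 2 * qInt k 3)) = t at *
  generalize Real.sqrt (qInt k 3) = u at *
  have n2 := h2.ne'
  have n3 := h3.ne'
  refine ⟨?_, ?_, ?_, ?_⟩
  · rw [show s * s * s * s = (s * s) * (s * s) by ring, hs]
    field_simp
  · rw [show t * t * s * s = (t * t) * (s * s) by ring, hs, ht]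
    field_simp
  · rw [show s * s * t * t = (t * t) * (s * s) by ring, hs, ht]
    field_simp
  · rw [show t * t * t * t = (t * t) * (t * t) by ring, ht]
    field_simp

/-- The two splitting trees `|0⟩`, `|1⟩` of the qubit `V^{τττ}_τ`. -/
def qubitLabel {k : ℕ} (hk : 2 ≤ k) (x : Fin 2) : InternalLabel k 1 1 :=
  ⟨⟨2 * x, by omega⟩, by fin_cases x <;> simp [Admissible] <;> omega⟩

/-- For `k ≥ 2`, the space `V^{τττ}_τ` is a qubit. -/
def qubitEquiv {k : ℕ} (hk : 2 ≤ k) : Fin 2 ≃ InternalLabel k 1 1 where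
  toFun := qubitLabel hk
  invFun m := ⟨m.spin2 / 2, by
    have := m.2; simp only [Admissible] at this; simp only [InternalLabel.spin2]; omega⟩
  left_inv x := by ext; simp [qubitLabel, InternalLabel.spin2]
  right_inv m := by
    have h := m.2
    simp only [Admissible] at h
    apply Subtype.ext
    apply Fin.ext
    simp only [qubitLabel, InternalLabel.spin2]
    omega

theorem spin2_qubitEquiv {k : ℕ} (hk : 2 ≤ k) (x : Fin 2) :
    (qubitEquiv hk x).spin2 = 2 * x := rfl

theorem norm_qPow (k : ℕ) (x : ℝ) : ‖qPow k x‖ = 1 := by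
  rw [qPow, show 2 * (Real.pi : ℂ) * Complex.I * x / (k + 2) =
    ((2 * Real.pi * x / (k + 2) : ℝ) : ℂ) * Complex.I by push_cast; ring]
  exact Complex.norm_exp_ofReal_mul_I _

theorem qPow_add (k : ℕ) (x y : ℝ) : qPow k (x + y) = qPow k x * qPow k y := by
  rw [qPow, qPow, qPow, ← Complex.exp_add]
  congr 1
  push_cast
  ring

theorem Rsymbol_zero (k : ℕ) : Rsymbol k 1 1 0 = -qPow k (-(3 / 4)) := by
  norm_num [Rsymbol]

theorem Rsymbol_two (k : ℕ) : Rsymbol k 1 1 2 = qPow k (1 / 4) := by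
  norm_num [Rsymbol]

/-- The matrices `R` and `F` of the qubit in the basis `|0⟩`, `|1⟩`. -/
theorem Rmat_reindex {k : ℕ} (hk : 2 ≤ k) :
    (Rmat k 1 1).submatrix (qubitEquiv hk) (qubitEquiv hk) =
      !![-qPow k (-(3 / 4)), 0; 0, qPow k (1 / 4)] := by
  rw [Rmat, Matrix.submatrix_diagonal_equiv]
  ext i j
  fin_cases i <;> fin_cases j <;>
    simp [spin2_qubitEquiv, Rsymbol_zero, Rsymbol_two]

theorem Fmat_reindex {k : ℕ} (hk : 2 ≤ k) :
    (Fmat k 1 1).submatrix (qubitEquiv hk) (qubitEquiv hk) =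
      !![-(1 / (qInt k 2 : ℂ)), (Real.sqrt (qInt k 3) : ℂ) / qInt k 2;
        (Real.sqrt (qInt k 3) : ℂ) / qInt k 2, 1 / (qInt k 2 : ℂ)] := by
  obtain ⟨h1, h2, h3, h4⟩ := Fsymbol_values hk
  ext i j
  fin_cases i <;> fin_cases j <;>
    simp [Fmat, spin2_qubitEquiv, h1, h2, h3, h4]

theorem qInt_two_eq (k : ℕ) : (qInt k 2 : ℂ) = qPow k (1 / 4) ^ 2 + (qPow k (1 / 4))⁻¹ ^ 2 := by
  have h : (qPow k (1 / 4))⁻¹ = qPow k (-(1 / 4)) := by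
    rw [qPow, qPow, ← Complex.exp_neg]
    congr 1
    push_cast
    ring
  rw [h, pow_two, pow_two, ← qPow_add, ← qPow_add, qInt_two, Complex.ofReal_mul,
    Complex.ofReal_cos, Complex.cos, qPow, qPow]
  push_cast
  rw [mul_div_cancel₀ _ (two_ne_zero)]
  congr 2 <;> ring

theorem qPow_neg_three_quarters (k : ℕ) : qPow k (-(3 / 4)) = (qPow k (1 / 4))⁻¹ ^ 3 := by
  rw [qPow, qPow, ← Complex.exp_neg, ← Complex.exp_nat_mul]
  congr 1
  push_cast
  ring

theorem mat_ext {k : ℕ} (hk : 2 ≤ k) {A B : Matrix (InternalLabel k 1 1) (InternalLabel k 1 1) ℂ}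
    (h : A.submatrix (qubitEquiv hk) (qubitEquiv hk) =
      B.submatrix (qubitEquiv hk) (qubitEquiv hk)) : A = B := by
  ext i j
  have := congrFun (congrFun h ((qubitEquiv hk).symm i)) ((qubitEquiv hk).symm j)
  simpa using this

theorem Fmat_mul_self {k : ℕ} (hk : 2 ≤ k) : Fmat k 1 1 * Fmat k 1 1 = 1 := by
  obtain ⟨h2, h2'⟩ := two_le_qInt_two_sq hk
  have h3 : 0 ≤ qInt k 3 := by rw [qInt_three]; linarith
  have hu : (Real.sqrt (qInt k 3) : ℂ) ^ 2 = (qInt k 2 : ℂ) ^ 2 - 1 := by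
    rw [← Complex.ofReal_pow, Real.sq_sqrt h3, qInt_three]
    push_cast
    rfl
  have hd : (qInt k 2 : ℂ) ≠ 0 := by exact_mod_cast h2.ne'
  apply mat_ext hk
  rw [← Matrix.submatrix_mul_equiv _ _ _ (qubitEquiv hk), Fmat_reindex, Matrix.submatrix_one_equiv]
  generalize (Real.sqrt (qInt k 3) : ℂ) = u at *
  generalize (qInt k 2 : ℂ) = d at *
  ext i j
  fin_cases i <;> fin_cases j <;> simp [Matrix.mul_apply, Fin.sum_univ_two] <;> field_simp <;>
    first | ring1 | linear_combination hu

theorem Fmat_inv {k : ℕ} (hk : 2 ≤ k) : (Fmat k 1 1)⁻¹ = Fmat k 1 1 :=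
  Matrix.inv_eq_left_inv (Fmat_mul_self hk)

theorem Fmat_conjTranspose {k : ℕ} (hk : 2 ≤ k) : (Fmat k 1 1).conjTranspose = Fmat k 1 1 := by
  apply mat_ext hk
  rw [← Matrix.conjTranspose_submatrix, Fmat_reindex]
  ext i j
  fin_cases i <;> fin_cases j <;> simp [Matrix.conjTranspose_apply]

theorem Rmat_mem_unitary (k : ℕ) : Rmat k 1 1 ∈ Matrix.unitaryGroup (InternalLabel k 1 1) ℂ := by
  rw [Matrix.mem_unitaryGroup_iff, Rmat, Matrix.star_eq_conjTranspose,
    Matrix.diagonal_conjTranspose, Matrix.diagonal_mul_diagonal, ← Matrix.diagonal_one]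
  congr 1
  ext m
  rw [Pi.star_apply, RCLike.star_def, Complex.mul_conj, Complex.normSq_eq_norm_sq, Rsymbol,
    norm_mul, norm_zpow, norm_qPow]
  simp

theorem Fmat_mem_unitary {k : ℕ} (hk : 2 ≤ k) :
    Fmat k 1 1 ∈ Matrix.unitaryGroup (InternalLabel k 1 1) ℂ := by
  rw [Matrix.mem_unitaryGroup_iff, Matrix.star_eq_conjTranspose, Fmat_conjTranspose hk,
    Fmat_mul_self hk]

theorem braidMat_mem_unitary {k : ℕ} (hk : 2 ≤ k) (i : Fin 2) :
    braidMat k 1 1 i ∈ Matrix.unitaryGroup (InternalLabel k 1 1) ℂ := by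
  rw [braidMat]
  split_ifs
  · exact Rmat_mem_unitary k
  · rw [Fmat_inv hk]
    exact mul_mem (mul_mem (Fmat_mem_unitary hk) (Rmat_mem_unitary k)) (Fmat_mem_unitary hk)

theorem braid_relation {k : ℕ} (hk : 2 ≤ k) :
    braidMat k 1 1 0 * braidMat k 1 1 1 * braidMat k 1 1 0 =
      braidMat k 1 1 1 * braidMat k 1 1 0 * braidMat k 1 1 1 := by
  obtain ⟨h2, h2'⟩ := two_le_qInt_two_sq hk
  have h3 : 0 ≤ qInt k 3 := by rw [qInt_three]; linarith
  have hu : (Real.sqrt (qInt k 3) : ℂ) ^ 2 = (qInt k 2 : ℂ) ^ 2 - 1 := by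
    rw [← Complex.ofReal_pow, Real.sq_sqrt h3, qInt_three]
    push_cast
    rfl
  have hd : (qInt k 2 : ℂ) ≠ 0 := by exact_mod_cast h2.ne'
  have hp : qPow k (1 / 4) ≠ 0 := by
    rw [← norm_ne_zero_iff, norm_qPow]; exact one_ne_zero
  simp only [braidMat, if_true, one_ne_zero, if_false, Fmat_inv hk]
  apply mat_ext hk
  simp only [← Matrix.submatrix_mul_equiv _ _ _ (qubitEquiv hk), Fmat_reindex, Rmat_reindex,
    qPow_neg_three_quarters]
  rw [qInt_two_eq] at *
  generalize (Real.sqrt (qInt k 3) : ℂ) = u at *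
  generalize qPow k (1 / 4) = p at *
  have hi : p * p⁻¹ = 1 := mul_inv_cancel₀ hp
  generalize p⁻¹ = w at *
  generalize hdd : p ^ 2 + w ^ 2 = d at *
  have hw : w ≠ 0 := right_ne_zero_of_mul_eq_one hi
  have hM : (!![-(1 / d), u / d; u / d, 1 / d] * !![-w ^ 3, 0; 0, p] *
      !![-(1 / d), u / d; u / d, 1 / d] : Matrix (Fin 2) (Fin 2) ℂ) =
      !![p ^ 3 / d, u * w / d; u * w / d, -w ^ 5 / d] := by
    ext i j
    fin_cases i <;> fin_cases j <;> simp [Matrix.mul_apply, Fin.sum_univ_two] <;> field_simp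
    all_goals grind
  rw [hM]
  ext i j
  fin_cases i <;> fin_cases j <;> simp [Matrix.mul_apply, Fin.sum_univ_two] <;> field_simp
  all_goals (clear hM; grind)

/-! ### The braid representation on the qubit -/

/-- The unitary operator on `V^{τττ}_τ` given by the counterclockwise braiding of the first two
(index `0`), respectively the last two (index `1`), of the three anyons `τ`. -/
noncomputable def braidUnitary {k : ℕ} (hk : 2 ≤ k) (i : Fin 2) :
    unitary (ThreeAnyonSpace k 1 1 →L[ℂ] ThreeAnyonSpace k 1 1) :=
  ⟨Matrix.toEuclideanCLM (𝕜 := ℂ) (braidMat k 1 1 i), by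
    obtain ⟨h1, h2⟩ := Unitary.mem_iff.mp (braidMat_mem_unitary hk i)
    rw [Unitary.mem_iff, ← map_star, ← map_mul, ← map_mul, h1, h2, map_one]
    exact ⟨rfl, rfl⟩⟩

theorem braidUnitary_rels {k : ℕ} (hk : 2 ≤ k) :
    ∀ r ∈ braidRels 3, FreeGroup.lift (braidUnitary hk) r = 1 := by
  apply lift_braidRels_three
  apply Subtype.ext
  change Matrix.toEuclideanCLM (𝕜 := ℂ) (braidMat k 1 1 0) *
      Matrix.toEuclideanCLM (𝕜 := ℂ) (braidMat k 1 1 1) *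
      Matrix.toEuclideanCLM (𝕜 := ℂ) (braidMat k 1 1 0) =
    Matrix.toEuclideanCLM (𝕜 := ℂ) (braidMat k 1 1 1) *
      Matrix.toEuclideanCLM (𝕜 := ℂ) (braidMat k 1 1 0) *
      Matrix.toEuclideanCLM (𝕜 := ℂ) (braidMat k 1 1 1)
  rw [← map_mul, ← map_mul, ← map_mul, ← map_mul, braid_relation hk]

/-- The representation `ρ_k : B_3 → U(V^{τττ}_τ)` by braiding three anyons of type `τ = 1/2`. -/
noncomputable def qubitRep {k : ℕ} (hk : 2 ≤ k) :
    BraidGroup 3 →* unitary (ThreeAnyonSpace k 1 1 →L[ℂ] ThreeAnyonSpace k 1 1) :=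
  PresentedGroup.toGroup (braidUnitary_rels hk)

/-- `ρ_k(σ₁)` is the diagonal operator `R`. -/
theorem qubitRep_sigma_one {k : ℕ} (hk : 2 ≤ k) :
    (qubitRep hk (braidSigma (n := 3) (0 : Fin 2)) :
      ThreeAnyonSpace k 1 1 →L[ℂ] ThreeAnyonSpace k 1 1) =
      Matrix.toEuclideanCLM (𝕜 := ℂ) (Rmat k 1 1) := by
  rw [qubitRep, braidSigma, PresentedGroup.toGroup.of]
  rfl

/-- `ρ_k(σ₂)` is the operator `F⁻¹ R F`. -/
theorem qubitRep_sigma_two {k : ℕ} (hk : 2 ≤ k) :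
    (qubitRep hk (braidSigma (n := 3) (1 : Fin 2)) :
      ThreeAnyonSpace k 1 1 →L[ℂ] ThreeAnyonSpace k 1 1) =
      Matrix.toEuclideanCLM (𝕜 := ℂ) ((Fmat k 1 1)⁻¹ * Rmat k 1 1 * Fmat k 1 1) := by
  rw [qubitRep, braidSigma, PresentedGroup.toGroup.of]
  rfl

end SU2k

/-!
Write `q = exp (2πi / (k + 2))`, `t = q + q⁻¹` and let `A`, `B` be the matrices of `ρ_k(σ₁²)` and
`ρ_k(σ₂²)` in the basis `|0⟩`, `|1⟩`. The proof has an arithmetic and a topological part.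

*Arithmetic.* The matrix `A B⁻¹` has determinant `1` and trace `t² - t` (`trace_sigma_sq`). If it
had finite order modulo scalars, its trace would be `z + z⁻¹` for a root of unity `z`, and all
conjugates of the trace would have absolute value at most `2`. For `k ≠ 4, 8` there is a unit `a`
modulo `n = k + 2` with `n / 3 < a ≤ n / 2`; the conjugation `q ↦ q ^ a` sends `t` to
`2 cos (2πa / n) < -1` and hence `t² - t` to a number greater than `2`
(`trace_ne_add_inv_of_pow_eq_one`). So `A B⁻¹` has infinite order modulo scalars.

*Topology.* Let `K` be the closure in `U(2)` of the group generated by `A`, `B` and the scalars.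
In an eigenbasis of `A B⁻¹`, the group `K` contains the closure of the powers of `A B⁻¹`, and with
the scalars this is the whole diagonal torus (`diagPhase_mem_of_pow_ne_pow`). In that basis `A` is
not diagonal, since `A` and `B` do not commute, and not antidiagonal, since `A²` is not a scalar.
By the polar decomposition `u = D₁ * rot x * D₂` with diagonal `D₁`, `D₂`, membership of `u` in `K`
depends on the angle `x` only, and the angles in question form a closed subgroup of `ℝ`. This
subgroup contains arbitrarily small positive elements, so it is `ℝ`, and `K` is everything
(`eq_top_of_forall_diagPhase_mem`).
-/

/-! ### A trace with an unbounded Galois conjugate -/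

/-- Apart from `6` and `10`, every `n ≥ 5` has a unit modulo `n` in the interval `(n/3, n/2]`. -/
theorem exists_coprime_third_half {n : ℕ} (hn : 5 ≤ n) (h6 : n ≠ 6) (h10 : n ≠ 10) :
    ∃ a : ℕ, a.Coprime n ∧ n < 3 * a ∧ 2 * a ≤ n := by
  obtain ⟨m, rfl | rfl | rfl⟩ : ∃ m, n = 2 * m + 1 ∨ n = 4 * m ∨ n = 4 * m + 2 :=
    ⟨if n % 2 = 1 then n / 2 else n / 4, by split_ifs <;> omega⟩
  · refine ⟨m, ?_, by omega, by omega⟩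
    simp
  · refine ⟨2 * m - 1, ?_, by omega, by omega⟩
    obtain ⟨l, rfl⟩ : ∃ l, m = l + 1 := ⟨m - 1, by omega⟩
    rw [show 4 * (l + 1) = 2 + 2 * (2 * (l + 1) - 1) by omega, Nat.coprime_add_mul_right_right,
      Nat.coprime_two_right, Nat.odd_iff]
    omega
  · refine ⟨2 * m - 1, ?_, by omega, by omega⟩
    obtain ⟨l, rfl⟩ : ∃ l, m = l + 1 := ⟨m - 1, by omega⟩
    rw [show 4 * (l + 1) + 2 = 2 ^ 2 + 2 * (2 * (l + 1) - 1) by omega,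
      Nat.coprime_add_mul_right_right]
    apply Nat.Coprime.pow_right
    rw [Nat.coprime_two_right, Nat.odd_iff]
    omega

/-- An algebraic conjugation carries one primitive `n`-th root of unity to another, and hence
carries polynomial relations with other algebraic numbers along. -/
theorem IsPrimitiveRoot.exists_algHom_algebraicClosure {n : ℕ} (hn : 0 < n) {q r : ℂ}
    (hq : IsPrimitiveRoot q n) (hr : IsPrimitiveRoot r n) :
    ∃ φ : algebraicClosure ℚ ℂ →ₐ[ℚ] ℂ,
      ∀ x : algebraicClosure ℚ ℂ, (x : ℂ) = q → φ x = r := by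
  have hx : IsIntegral ℚ q := (hq.isIntegral hn).tower_top
  obtain ⟨φ, hφ⟩ := IntermediateField.exists_algHom_of_splits_of_aeval
    (F := ℚ) (E := algebraicClosure ℚ ℂ) (K := ℂ)
    (fun s => ⟨((algebraicClosure.isAlgebraic ℚ ℂ).isAlgebraic s).isIntegral, IsAlgClosed.splits _⟩)
    (x := ⟨q, mem_algebraicClosure_iff.mpr hx.isAlgebraic⟩) (y := r) (by
      rw [← minpoly.algebraMap_eq (algebraMap (algebraicClosure ℚ ℂ) ℂ).injective]
      change Polynomial.aeval r (minpoly ℚ q) = 0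
      rw [← Polynomial.cyclotomic_eq_minpoly_rat hq hn,
        Polynomial.cyclotomic_eq_minpoly_rat hr hn]
      exact minpoly.aeval ℚ r)
  exact ⟨φ, fun x hx => by rw [← hφ]; congr 1; exact Subtype.ext hx⟩

/-- For `t = q + q⁻¹` with `q = exp (2πi / n)`, the number `t² - t` is not the trace of a
determinant-one matrix of finite order: the conjugate of `t² - t` belonging to a unit in
`(n/3, n/2]` exceeds `2`. -/
theorem trace_ne_add_inv_of_pow_eq_one {n : ℕ} (hn : 5 ≤ n) (h6 : n ≠ 6) (h10 : n ≠ 10)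
    {q z : ℂ} (hq : q = Complex.exp (2 * Real.pi * Complex.I / n)) {m : ℕ} (hm : 0 < m)
    (hz : z ^ m = 1) : (q + q⁻¹) ^ 2 - (q + q⁻¹) ≠ z + z⁻¹ := by
  intro h
  obtain ⟨a, ha, h3, h2⟩ := exists_coprime_third_half hn h6 h10
  have hqn : IsPrimitiveRoot q n := hq ▸ Complex.isPrimitiveRoot_exp n (by omega)
  obtain ⟨φ, hφ⟩ := hqn.exists_algHom_algebraicClosure (by omega) (hqn.pow_of_coprime a ha)
  have hqi : IsAlgebraic ℚ q := (hqn.isIntegral (by omega)).tower_top.isAlgebraic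
  have hzi : IsAlgebraic ℚ z :=
    (IsIntegral.of_pow hm (hz ▸ isIntegral_one)).isAlgebraic
  let Q : algebraicClosure ℚ ℂ := ⟨q, mem_algebraicClosure_iff.mpr hqi⟩
  let Z : algebraicClosure ℚ ℂ := ⟨z, mem_algebraicClosure_iff.mpr hzi⟩
  have hQZ : (Q + Q⁻¹) ^ 2 - (Q + Q⁻¹) = Z + Z⁻¹ := Subtype.ext h
  have hZ : Z ^ m = 1 := Subtype.ext hz
  have hφZ : ‖φ Z‖ = 1 :=
    Complex.norm_eq_one_of_pow_eq_one (by rw [← map_pow, hZ, map_one]) hm.ne'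
  have hφ2 : ‖φ Z + (φ Z)⁻¹‖ ≤ 2 := by
    refine (norm_add_le _ _).trans ?_
    rw [norm_inv, hφZ]
    norm_num
  have hval : (q ^ a + (q ^ a)⁻¹) ^ 2 - (q ^ a + (q ^ a)⁻¹) = φ Z + (φ Z)⁻¹ := by
    rw [← hφ Q rfl, ← map_inv₀, ← map_inv₀, ← map_add, ← map_add, ← map_pow, ← map_sub, hQZ]
  set θ : ℝ := 2 * Real.pi * a / n with hθ
  have hn0 : (0 : ℝ) < n := by exact_mod_cast (by omega : 0 < n)
  have hqa : q ^ a + (q ^ a)⁻¹ = ((2 * Real.cos θ : ℝ) : ℂ) := by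
    have : q ^ a = Complex.exp ((θ : ℂ) * Complex.I) := by
      rw [hq, ← Complex.exp_nat_mul, hθ]
      congr 1
      push_cast
      ring
    rw [this, ← Complex.exp_neg]
    push_cast
    rw [Complex.cos]
    ring_nf
  have hcos : Real.cos θ < -(1 / 2) := by
    have e : Real.cos (2 * Real.pi / 3) = -(1 / 2) := by
      rw [show 2 * Real.pi / 3 = Real.pi - Real.pi / 3 by ring, Real.cos_pi_sub,
        Real.cos_pi_div_three]
    rw [← e]
    have h3' : (n : ℝ) < 3 * a := by exact_mod_cast h3
    have h2' : 2 * (a : ℝ) ≤ n := by exact_mod_cast h2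
    apply Real.cos_lt_cos_of_nonneg_of_le_pi
    · positivity
    · rw [hθ, div_le_iff₀ hn0]
      nlinarith [Real.pi_pos]
    · rw [hθ, div_lt_div_iff₀ (by norm_num) hn0]
      nlinarith [Real.pi_pos]
  rw [← hval, hqa, ← Complex.ofReal_pow, ← Complex.ofReal_sub, Complex.norm_real] at hφ2
  have := (le_abs_self _).trans hφ2
  nlinarith

/-! ### Closed subgroups of `U(2)` -/

namespace UnitaryTwo

open Matrix

/-- The unitary group `U(2)`. -/
abbrev U2 : Type := Matrix.unitaryGroup (Fin 2) ℂ

/-- The diagonal unitary matrix with diagonal entries `a`, `b`. -/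
noncomputable def diagPhase (a b : Circle) : U2 :=
  ⟨!![(a : ℂ), 0; 0, (b : ℂ)], by
    rw [mem_unitaryGroup_iff]
    ext i j
    fin_cases i <;> fin_cases j <;>
      simp [Matrix.mul_apply, star_eq_conjTranspose, Complex.mul_conj,
        Circle.normSq_coe]⟩

/-- The real rotation by the angle `x`. -/
noncomputable def rot (x : ℝ) : U2 :=
  ⟨!![(Real.cos x : ℂ), -(Real.sin x : ℂ); (Real.sin x : ℂ), (Real.cos x : ℂ)], by
    have h : (Real.cos x : ℂ) * Real.cos x + Real.sin x * Real.sin x = 1 := by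
      exact_mod_cast (by nlinarith [Real.sin_sq_add_cos_sq x] :
        Real.cos x * Real.cos x + Real.sin x * Real.sin x = 1)
    rw [mem_unitaryGroup_iff]
    ext i j
    fin_cases i <;> fin_cases j <;>
      simp only [Matrix.mul_apply, star_eq_conjTranspose, conjTranspose_apply, Fin.sum_univ_two,
        Fin.zero_eta, Fin.mk_one, of_apply, cons_val_zero, cons_val_one, map_neg,
        RCLike.star_def, Complex.conj_ofReal, one_apply_eq, ne_eq, one_ne_zero, zero_ne_one,
        not_false_eq_true, one_apply_ne, cons_val', cons_val_fin_one] <;>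
      first | ring1 | linear_combination h⟩

theorem diagPhase_mul (a b c d : Circle) :
    diagPhase a b * diagPhase c d = diagPhase (a * c) (b * d) := by
  apply Subtype.ext
  simp [diagPhase]

theorem diagPhase_one : diagPhase 1 1 = 1 := by
  apply Subtype.ext
  ext i j
  fin_cases i <;> fin_cases j <;> simp [diagPhase]

theorem rot_add (x y : ℝ) : rot (x + y) = rot x * rot y := by
  apply Subtype.ext
  ext i j
  fin_cases i <;> fin_cases j <;> simp [rot, Complex.cos_add, Complex.sin_add] <;> ring

theorem rot_zero : rot 0 = 1 := by
  apply Subtype.ext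
  ext i j
  fin_cases i <;> fin_cases j <;> simp [rot]

theorem continuous_diagPhase : Continuous fun p : Circle × Circle => diagPhase p.1 p.2 := by
  refine Continuous.subtype_mk (continuous_matrix fun i j => ?_) _
  fin_cases i <;> fin_cases j <;> simp <;> fun_prop

theorem continuous_rot : Continuous rot := by
  refine Continuous.subtype_mk (continuous_matrix fun i j => ?_) _
  fin_cases i <;> fin_cases j <;> simp <;> fun_prop

theorem row_normalized (u : U2) :
    u.1 0 0 * star (u.1 0 0) + u.1 0 1 * star (u.1 0 1) = 1 := by
  have h := congrFun (congrFun (mem_unitaryGroup_iff.mp u.2) 0) 0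
  simpa [Matrix.mul_apply, star_eq_conjTranspose, Fin.sum_univ_two] using h

theorem column_orthonormal (u : U2) :
    star (u.1 0 0) * u.1 0 0 + star (u.1 1 0) * u.1 1 0 = 1 ∧
    star (u.1 0 0) * u.1 0 1 + star (u.1 1 0) * u.1 1 1 = 0 ∧
    star (u.1 0 1) * u.1 0 1 + star (u.1 1 1) * u.1 1 1 = 1 := by
  have h := mem_unitaryGroup_iff'.mp u.2
  have e := fun i j => congrFun (congrFun h i) j
  simp only [Matrix.mul_apply, star_eq_conjTranspose, conjTranspose_apply, Fin.sum_univ_two] at e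
  exact ⟨by simpa using e 0 0, by simpa using e 0 1, by simpa using e 1 1⟩

theorem norm_sq_add_norm_sq (u : U2) :
    ‖u.1 0 0‖ ^ 2 + ‖u.1 0 1‖ ^ 2 = 1 ∧ ‖u.1 0 0‖ ^ 2 + ‖u.1 1 0‖ ^ 2 = 1 ∧
      ‖u.1 0 1‖ ^ 2 + ‖u.1 1 1‖ ^ 2 = 1 := by
  have key : ∀ z : ℂ, z * star z = ((‖z‖ ^ 2 : ℝ) : ℂ) := fun z => by
    rw [RCLike.star_def, Complex.mul_conj, Complex.normSq_eq_norm_sq]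
  have h1 := row_normalized u
  obtain ⟨h2, -, h3⟩ := column_orthonormal u
  simp only [mul_comm (star _), key] at h1 h2 h3
  exact ⟨by exact_mod_cast h1, by exact_mod_cast h2, by exact_mod_cast h3⟩

theorem exists_circle_mul_norm (z : ℂ) : ∃ a : Circle, z = a * (‖z‖ : ℂ) :=
  ⟨Circle.exp z.arg, by rw [Circle.coe_exp, mul_comm, Complex.norm_mul_exp_arg_mul_I]⟩

/-- The polar (`KAK`) decomposition of `U(2)`: up to diagonal factors, a unitary matrix is the
rotation whose cosine is the modulus of its upper left entry. -/
theorem exists_eq_diagPhase_mul_rot_mul_diagPhase (u : U2) {x : ℝ} (hc : ‖u.1 0 0‖ = Real.cos x)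
    (hs : 0 ≤ Real.sin x) : ∃ a b c d : Circle, u = diagPhase a b * rot x * diagPhase c d := by
  obtain ⟨h1, h2, h3⟩ := norm_sq_add_norm_sq u
  have hsc := Real.sin_sq_add_cos_sq x
  have hc0 : 0 ≤ Real.cos x := hc ▸ norm_nonneg _
  have n01 : ‖u.1 0 1‖ = Real.sin x := by
    rw [← abs_of_nonneg hs, ← abs_of_nonneg (norm_nonneg (u.1 0 1)), ← sq_eq_sq_iff_abs_eq_abs]
    rw [hc] at h1; linarith
  have n10 : ‖u.1 1 0‖ = Real.sin x := by
    rw [← abs_of_nonneg hs, ← abs_of_nonneg (norm_nonneg (u.1 1 0)), ← sq_eq_sq_iff_abs_eq_abs]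
    rw [hc] at h2; linarith
  have n11 : ‖u.1 1 1‖ = Real.cos x := by
    rw [← abs_of_nonneg hc0, ← abs_of_nonneg (norm_nonneg (u.1 1 1)), ← sq_eq_sq_iff_abs_eq_abs]
    rw [n01] at h3; linarith
  obtain ⟨a, ha⟩ := exists_circle_mul_norm (u.1 0 0)
  obtain ⟨b, hb⟩ := exists_circle_mul_norm (u.1 0 1)
  obtain ⟨c, hc'⟩ := exists_circle_mul_norm (u.1 1 0)
  obtain ⟨d, hd⟩ := exists_circle_mul_norm (u.1 1 1)
  rw [hc] at ha
  rw [n01] at hb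
  rw [n10] at hc'
  rw [n11] at hd
  have entries : ∀ a' b' c' d' : Circle,
      (diagPhase a' b' * rot x * diagPhase c' d').1 =
        !![(a' : ℂ) * Real.cos x * c', -(a' * Real.sin x * d');
          b' * Real.sin x * c', b' * Real.cos x * d'] := by
    intro a' b' c' d'
    ext i j
    fin_cases i <;> fin_cases j <;> simp [diagPhase, rot]
  have finish : ∀ a' b' c' d' : Circle, u.1 0 0 = a' * Real.cos x * c' →
      u.1 0 1 = -(a' * Real.sin x * d') → u.1 1 0 = b' * Real.sin x * c' →
      u.1 1 1 = b' * Real.cos x * d' →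
      ∃ a b c d : Circle, u = diagPhase a b * rot x * diagPhase c d := by
    intro a' b' c' d' e1 e2 e3 e4
    refine ⟨a', b', c', d', Subtype.ext ?_⟩
    rw [entries]
    ext i j
    fin_cases i <;> fin_cases j <;> simpa [-Complex.ofReal_cos, -Complex.ofReal_sin]
  rcases eq_or_ne (Real.sin x) 0 with s0 | s0
  · exact finish a d 1 1 (by simpa using ha) (by simpa [s0] using hb) (by simpa [s0] using hc')
      (by simpa using hd)
  rcases eq_or_ne (Real.cos x) 0 with c0 | c0
  · exact finish (-b) c 1 1 (by simpa [c0] using ha) (by simpa using hb) (by simpa using hc')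
      (by simpa [c0] using hd)
  -- In the generic case the last entry is forced by the orthogonality of the columns.
  · refine finish a c 1 (-(b * a⁻¹)) (by simpa using ha) ?_ (by simpa using hc') ?_
    · rw [hb]
      simp
      field_simp
    · obtain ⟨-, ho, -⟩ := column_orthonormal u
      rw [ha, hb, hc'] at ho
      simp only [star_mul', RCLike.star_def, Complex.conj_ofReal, ← Circle.coe_inv_eq_conj] at ho
      have c0' : (Real.cos x : ℂ) ≠ 0 := by exact_mod_cast c0
      have s0' : (Real.sin x : ℂ) ≠ 0 := by exact_mod_cast s0
      have := a.coe_ne_zero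
      have := c.coe_ne_zero
      simp only [Circle.coe_inv] at ho
      simp only [Circle.coe_neg, Circle.coe_mul, Circle.coe_inv]
      field_simp at ho ⊢
      have ho' := (mul_eq_zero.mp (ho.trans (mul_zero _))).resolve_left s0'
      linear_combination ho'

/-- A closed subgroup of the circle containing an element of infinite order is the circle. -/
theorem circle_subgroup_eq_top {K : Subgroup Circle} (hK : IsClosed (K : Set Circle)) {z : Circle}
    (hz : z ∈ K) (hz' : ∀ m : ℕ, 0 < m → z ^ m ≠ 1) : K = ⊤ := by
  let S : AddSubgroup ℝ := (Subgroup.toAddSubgroup K).comap Circle.expHom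
  have hmem : ∀ x : ℝ, x ∈ S ↔ Circle.exp x ∈ K := fun x => Iff.rfl
  have hS : IsClosed (S : Set ℝ) := hK.preimage Circle.exp.continuous
  obtain ⟨x, rfl⟩ := Circle.exp_surjective z
  have hirr : Irrational (x / (2 * Real.pi)) := by
    rintro ⟨r, hr⟩
    refine hz' r.den r.den_pos ?_
    rw [← Circle.exp_nsmul, Circle.exp_eq_one]
    have hr' : (r.num : ℝ) / r.den = x / (2 * Real.pi) := by rw [← hr, Rat.cast_def]
    have hd : (r.den : ℝ) ≠ 0 := by exact_mod_cast r.den_nz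
    refine ⟨r.num, ?_⟩
    rw [nsmul_eq_mul]
    field_simp at hr'
    linarith
  have hd : Dense (S : Set ℝ) := by
    refine (dense_addSubgroupClosure_pair_iff.mpr hirr).mono ?_
    rw [SetLike.coe_subset_coe, AddSubgroup.closure_le]
    rintro y (rfl | rfl)
    · exact hz
    · exact (hmem _).mpr (by simp [Circle.exp_two_pi])
  rw [eq_top_iff]
  intro w _
  obtain ⟨y, rfl⟩ := Circle.exp_surjective w
  rw [← hmem, ← SetLike.mem_coe, hS.closure_eq.symm, hd.closure_eq]
  trivial

/-- The rotations lying in a subgroup of `U(2)`, as a subgroup of the additive group of angles. -/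
noncomputable def rotAngles (K : Subgroup U2) : AddSubgroup ℝ where
  carrier := {x | rot x ∈ K}
  zero_mem' := by simp [rot_zero, K.one_mem]
  add_mem' hx hy := by
    rw [Set.mem_ofPred_eq, rot_add]
    exact K.mul_mem hx hy
  neg_mem' {x} hx := by
    have h : rot (-x) = (rot x)⁻¹ := by
      rw [eq_inv_iff_mul_eq_one, ← rot_add, neg_add_cancel, rot_zero]
    rw [Set.mem_ofPred_eq, h]
    exact K.inv_mem hx

theorem mem_rotAngles {K : Subgroup U2} {x : ℝ} : x ∈ rotAngles K ↔ rot x ∈ K := Iff.rfl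

theorem norm_entry_le_one (u : U2) : ‖u.1 0 0‖ ≤ 1 := by
  obtain ⟨h, -, -⟩ := norm_sq_add_norm_sq u
  nlinarith [sq_nonneg ‖u.1 0 1‖, norm_nonneg (u.1 0 0)]

theorem exists_eq_diagPhase_mul_rot_arccos_mul_diagPhase (u : U2) :
    ∃ a b c d : Circle, u = diagPhase a b * rot (Real.arccos ‖u.1 0 0‖) * diagPhase c d := by
  apply exists_eq_diagPhase_mul_rot_mul_diagPhase
  · rw [Real.cos_arccos (by linarith [norm_nonneg (u.1 0 0)]) (norm_entry_le_one u)]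
  · exact Real.sin_nonneg_of_mem_Icc ⟨Real.arccos_nonneg _, Real.arccos_le_pi _⟩

/-- A subgroup containing the diagonal torus contains, with each element, the rotation in its polar
decomposition. -/
theorem arccos_norm_entry_mem_rotAngles {K : Subgroup U2} (hd : ∀ a b : Circle, diagPhase a b ∈ K)
    {u : U2} (hu : u ∈ K) : Real.arccos ‖u.1 0 0‖ ∈ rotAngles K := by
  obtain ⟨a, b, c, d, h⟩ := exists_eq_diagPhase_mul_rot_arccos_mul_diagPhase u
  rw [h] at hu
  exact (K.mul_mem_cancel_left (hd a b)).mp ((K.mul_mem_cancel_right (hd c d)).mp hu)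

/-- A closed subgroup of `U(2)` containing the diagonal torus and an element outside its
normalizer is everything. The polar decomposition of `rot x * diagPhase z 1 * rot (-x)` provides
arbitrarily small rotations as `z` tends to `1`. -/
theorem eq_top_of_forall_diagPhase_mem {K : Subgroup U2} (hK : IsClosed (K : Set U2))
    (hd : ∀ a b : Circle, diagPhase a b ∈ K) {w : U2} (hw : w ∈ K) (h0 : w.1 0 0 ≠ 0)
    (h1 : w.1 0 1 ≠ 0) : K = ⊤ := by
  set x := Real.arccos ‖w.1 0 0‖ with hx
  have hxK : x ∈ rotAngles K := arccos_norm_entry_mem_rotAngles hd hw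
  have hcos : Real.cos x = ‖w.1 0 0‖ :=
    Real.cos_arccos (by linarith [norm_nonneg (w.1 0 0)]) (norm_entry_le_one w)
  have hsc := Real.sin_sq_add_cos_sq x
  have hc : 0 < Real.cos x ^ 2 := by
    rw [hcos]
    have := norm_pos_iff.mpr h0
    positivity
  have hs : 0 < Real.sin x ^ 2 := by
    have := norm_pos_iff.mpr h1
    have := (norm_sq_add_norm_sq w).1
    rw [hcos] at hsc
    nlinarith
  let v : ℝ → U2 := fun θ => rot x * diagPhase (Circle.exp θ) 1 * rot (-x)
  have hvK : ∀ θ, v θ ∈ K := fun θ =>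
    K.mul_mem (K.mul_mem hxK (hd _ _)) ((rotAngles K).neg_mem hxK)
  have hentry : ∀ θ, (v θ).1 0 0 =
      ((Real.cos x ^ 2 : ℝ) : ℂ) * Complex.exp (θ * Complex.I) + ((Real.sin x ^ 2 : ℝ) : ℂ) := by
    intro θ
    simp [v, rot, diagPhase]
    ring
  have hnorm : ∀ θ, ‖(v θ).1 0 0‖ ^ 2 =
      1 - 2 * (Real.cos x ^ 2 * Real.sin x ^ 2) * (1 - Real.cos θ) := by
    intro θ
    rw [hentry, Complex.exp_mul_I, ← Complex.ofReal_cos, ← Complex.ofReal_sin,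
      ← Complex.normSq_eq_norm_sq, Complex.normSq_apply]
    simp only [Complex.add_re, Complex.mul_re, Complex.ofReal_re, Complex.ofReal_im,
      Complex.add_im, Complex.mul_im, Complex.I_re, Complex.I_im]
    have := Real.sin_sq_add_cos_sq θ
    generalize Real.cos x ^ 2 = p at *
    generalize Real.sin x ^ 2 = r at *
    obtain rfl : p = 1 - r := by linarith
    linear_combination (1 - r) ^ 2 * this
  have hcont : Continuous fun θ => Real.arccos ‖(v θ).1 0 0‖ := by
    simp only [hentry]
    fun_prop
  have hv0 : Real.arccos ‖(v 0).1 0 0‖ = 0 := by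
    have h := hnorm 0
    rw [Real.cos_zero, sub_self, mul_zero, sub_zero] at h
    rw [Real.arccos_eq_zero]
    nlinarith [norm_nonneg ((v 0).1 0 0)]
  have hdense : Dense (rotAngles K : Set ℝ) := by
    refine AddSubgroup.dense_of_not_isolated_zero _ fun ε hε => ?_
    have hev : ∀ᶠ θ in nhdsWithin 0 (Set.Ioi (0 : ℝ)), Real.arccos ‖(v θ).1 0 0‖ < ε :=
      nhdsWithin_le_nhds (hcont.continuousAt.eventually_lt continuousAt_const (by rwa [hv0]))
    obtain ⟨θ, hθ, hθ0, hθπ⟩ := (hev.and (Ioo_mem_nhdsGT Real.pi_pos)).exists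
    refine ⟨_, arccos_norm_entry_mem_rotAngles hd (hvK θ), ?_, hθ⟩
    rw [Real.arccos_pos]
    have hcθ : Real.cos θ < 1 := by
      rw [← Real.cos_zero]
      exact Real.cos_lt_cos_of_nonneg_of_le_pi le_rfl hθπ.le hθ0
    have : 0 < 2 * (Real.cos x ^ 2 * Real.sin x ^ 2) * (1 - Real.cos θ) := by
      have := sub_pos.mpr hcθ
      positivity
    have := hnorm θ
    nlinarith [norm_nonneg ((v θ).1 0 0)]
  have hclosed : IsClosed (rotAngles K : Set ℝ) := hK.preimage continuous_rot
  have hall : ∀ y : ℝ, rot y ∈ K := fun y => by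
    rw [← mem_rotAngles, ← SetLike.mem_coe, ← hclosed.closure_eq, hdense.closure_eq]
    trivial
  rw [eq_top_iff]
  intro u _
  obtain ⟨a, b, c, d, h⟩ := exists_eq_diagPhase_mul_rot_arccos_mul_diagPhase u
  rw [h]
  exact K.mul_mem (K.mul_mem (hd a b) (hall _)) (hd c d)

/-- A closed subgroup of `U(2)` containing the scalars and one diagonal element of infinite order
modulo scalars contains the diagonal torus. -/
theorem diagPhase_mem_of_pow_ne_pow {K : Subgroup U2} (hK : IsClosed (K : Set U2))
    (hc : ∀ c : Circle, diagPhase c c ∈ K) {l m : Circle} (hlm : diagPhase l m ∈ K)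
    (hne : ∀ n : ℕ, 0 < n → l ^ n ≠ m ^ n) (a b : Circle) : diagPhase a b ∈ K := by
  let f : Circle →* U2 :=
    { toFun := fun z => diagPhase z 1
      map_one' := diagPhase_one
      map_mul' := fun x y => by rw [diagPhase_mul, one_mul] }
  have hf : K.comap f = ⊤ := by
    have hcont : Continuous f := continuous_diagPhase.comp (continuous_id.prodMk continuous_const)
    refine circle_subgroup_eq_top (hK.preimage hcont) (z := l * m⁻¹) ?_ ?_
    · change diagPhase (l * m⁻¹) 1 ∈ K
      have := K.mul_mem hlm (hc m⁻¹)
      rwa [diagPhase_mul, mul_inv_cancel] at this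
    · intro n hn h
      rw [← div_eq_mul_inv, div_pow, div_eq_one] at h
      exact hne n hn h
  have hab : diagPhase (a * b⁻¹) 1 ∈ K := by
    change a * b⁻¹ ∈ K.comap f
    rw [hf]
    trivial
  have := K.mul_mem hab (hc b)
  rwa [diagPhase_mul, inv_mul_cancel_right, one_mul] at this

theorem exists_circle_eq {z : ℂ} (hz : ‖z‖ = 1) : ∃ a : Circle, z = a := by
  obtain ⟨a, ha⟩ := exists_circle_mul_norm z
  exact ⟨a, by rw [ha, hz]; simp⟩

/-- A triangular unitary matrix is diagonal. -/
theorem eq_diagPhase_of_entry_eq_zero {u : U2} (h : u.1 0 1 = 0 ∨ u.1 1 0 = 0) :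
    ∃ a b : Circle, u = diagPhase a b := by
  obtain ⟨h1, h2, h3⟩ := norm_sq_add_norm_sq u
  have h01 : u.1 0 1 = 0 := by
    rcases h with h | h
    · exact h
    · rw [h, norm_zero] at h2
      rw [← norm_eq_zero, ← sq_eq_zero_iff]
      linarith
  have h10 : u.1 1 0 = 0 := by
    rw [h01, norm_zero] at h1
    rw [← norm_eq_zero, ← sq_eq_zero_iff]
    linarith
  rw [h01, norm_zero] at h1 h3
  obtain ⟨a, ha⟩ := exists_circle_eq (z := u.1 0 0) (by
    have := norm_nonneg (u.1 0 0)
    nlinarith)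
  obtain ⟨b, hb⟩ := exists_circle_eq (z := u.1 1 1) (by
    have := norm_nonneg (u.1 1 1)
    nlinarith)
  refine ⟨a, b, Subtype.ext ?_⟩
  ext i j
  fin_cases i <;> fin_cases j <;> simpa [diagPhase]

/-- Every element of `U(2)` is diagonal in some orthonormal basis: a unit eigenvector is completed
to a special unitary matrix, and a triangular unitary matrix is diagonal. -/
theorem exists_conj_eq_diagPhase (g : U2) :
    ∃ (V : U2) (l m : Circle), V⁻¹ * g * V = diagPhase l m := by
  obtain ⟨c, hc⟩ := Module.End.exists_eigenvalue (Matrix.toLin' g.1)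
  obtain ⟨y, hy⟩ := hc.exists_hasEigenvector
  have hgy : g.1 *ᵥ y = c • y := by simpa using hy.apply_eq_smul
  have hr : 0 < ‖y 0‖ ^ 2 + ‖y 1‖ ^ 2 := by
    by_contra! h
    have e0 : ‖y 0‖ ^ 2 = 0 := by nlinarith [sq_nonneg ‖y 0‖, sq_nonneg ‖y 1‖]
    have e1 : ‖y 1‖ ^ 2 = 0 := by nlinarith [sq_nonneg ‖y 0‖, sq_nonneg ‖y 1‖]
    refine hy.2 (funext fun i => ?_)
    fin_cases i
    · simpa using e0
    · simpa using e1
  set r : ℝ := Real.sqrt (‖y 0‖ ^ 2 + ‖y 1‖ ^ 2)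
  have hr0 : (r : ℂ) ≠ 0 := by exact_mod_cast (Real.sqrt_pos.mpr hr).ne'
  have hrr : star (y 0) * y 0 + star (y 1) * y 1 = (r : ℂ) ^ 2 := by
    rw [← Complex.ofReal_pow, Real.sq_sqrt hr.le]
    simp [← Complex.normSq_eq_conj_mul_self, Complex.normSq_eq_norm_sq]
  let M : Matrix (Fin 2) (Fin 2) ℂ :=
    !![y 0 / r, -(star (y 1) / r); y 1 / r, star (y 0) / r]
  have hM : M ∈ Matrix.unitaryGroup (Fin 2) ℂ := by
    rw [mem_unitaryGroup_iff']
    simp only [RCLike.star_def] at hrr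
    ext i j
    fin_cases i <;> fin_cases j <;>
      simp [M, Matrix.mul_apply, star_eq_conjTranspose] <;> field_simp
    · linear_combination hrr
    · ring
    · ring
    · linear_combination hrr
  let V : U2 := ⟨M, hM⟩
  obtain ⟨l, m, h⟩ := eq_diagPhase_of_entry_eq_zero (u := V⁻¹ * g * V) (Or.inr (by
    change (star M * g.1 * M) 1 0 = 0
    have hcol : ∀ i, (g.1 * M) i 0 = c * M i 0 := by
      intro i
      have := congrFun hgy i
      simp only [mulVec, dotProduct, Fin.sum_univ_two, Pi.smul_apply, smul_eq_mul] at this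
      rw [Matrix.mul_apply, Fin.sum_univ_two]
      fin_cases i <;> simp [M] at this ⊢ <;> field_simp <;> linear_combination this
    have horth := congrFun (congrFun (mem_unitaryGroup_iff'.mp hM) 1) 0
    rw [Matrix.mul_apply, Fin.sum_univ_two] at horth
    rw [Matrix.mul_assoc, Matrix.mul_apply, Fin.sum_univ_two, hcol, hcol]
    simp only [one_apply_ne one_ne_zero] at horth
    linear_combination c * horth))
  exact ⟨V, l, m, h⟩

/-- Let a closed subgroup of `U(2)` contain the scalars and two elements `A`, `B` that do not
commute, with `A²` not a scalar. If `A B⁻¹` has determinant `1` and infinite order, then the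
subgroup is everything: in an eigenbasis of `A B⁻¹`, the matrix `A` is neither diagonal
nor antidiagonal. -/
theorem eq_top_of_mem_of_mem {K : Subgroup U2} (hK : IsClosed (K : Set U2))
    (hc : ∀ c : Circle, diagPhase c c ∈ K) {A B : U2} (hA : A ∈ K) (hB : B ∈ K)
    (hAB : A * B ≠ B * A)
    (hA2 : ∀ c : Circle, A * A ≠ diagPhase c c) (hdet : (A * B⁻¹).1.det = 1)
    (htr : ∀ (z : ℂ) (n : ℕ), 0 < n → z ^ n = 1 → (A * B⁻¹).1.trace ≠ z + z⁻¹) : K = ⊤ := by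
  obtain ⟨V, l, m, h⟩ := exists_conj_eq_diagPhase (A * B⁻¹)
  have hVV : V.1 * (V⁻¹).1 = 1 := congrArg Subtype.val (mul_inv_cancel V)
  have hval : (V⁻¹).1 * (A * B⁻¹).1 * V.1 = (diagPhase l m).1 := congrArg Subtype.val h
  have hlm1 : (l : ℂ) * m = 1 := by
    have := congrArg Matrix.det hval
    rw [Matrix.det_mul, Matrix.det_mul, hdet, mul_one, mul_comm, ← Matrix.det_mul, hVV,
      Matrix.det_one] at this
    simpa [diagPhase] using this.symm
  have hlm2 : (A * B⁻¹).1.trace = l + m := by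
    have := congrArg Matrix.trace hval
    rw [Matrix.trace_mul_comm, ← Matrix.mul_assoc, hVV, Matrix.one_mul] at this
    simpa [diagPhase, Matrix.trace_fin_two] using this
  have hml : (m : ℂ) = (l : ℂ)⁻¹ := eq_inv_of_mul_eq_one_right hlm1
  have hne : ∀ n : ℕ, 0 < n → l ^ n ≠ m ^ n := by
    intro n hn e
    refine htr l (2 * n) (by omega) ?_ (by rw [hlm2, hml])
    have e' : (l : ℂ) ^ n = (m : ℂ) ^ n := by exact_mod_cast congrArg Circle.coeHom e
    rw [two_mul, pow_add]
    nth_rewrite 2 [e']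
    rw [← mul_pow, hlm1, one_pow]
  have hscalar : ∀ (c : Circle) (u : U2), u * diagPhase c c = diagPhase c c * u := by
    intro c u
    apply Subtype.ext
    ext i j
    fin_cases i <;> fin_cases j <;> simp [diagPhase, Matrix.mul_apply, mul_comm]
  let f : U2 →* U2 := (MulAut.conj V).toMonoidHom
  have hf : ∀ u, f u = V * u * V⁻¹ := fun u => rfl
  have hfcont : Continuous f := by
    change Continuous fun u => V * u * V⁻¹
    fun_prop
  have hL : IsClosed (K.comap f : Set U2) := hK.preimage hfcont
  have hLc : ∀ c : Circle, diagPhase c c ∈ K.comap f := fun c => by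
    rw [Subgroup.mem_comap, hf, hscalar, mul_inv_cancel_right]
    exact hc c
  have hLg : diagPhase l m ∈ K.comap f := by
    rw [Subgroup.mem_comap, hf, ← h]
    simpa [mul_assoc] using K.mul_mem hA (K.inv_mem hB)
  set w : U2 := V⁻¹ * A * V with hw
  have hwL : w ∈ K.comap f := by
    rw [Subgroup.mem_comap, hf, hw]
    simpa [mul_assoc] using hA
  have hAw : A = V * w * V⁻¹ := by simp [hw, mul_assoc]
  have hgw : A * B⁻¹ = V * diagPhase l m * V⁻¹ := by simp [← h, mul_assoc]
  have hw01 : w.1 0 1 ≠ 0 := by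
    intro e
    obtain ⟨a, b, hab⟩ := eq_diagPhase_of_entry_eq_zero (Or.inl e)
    have hcomm : A * (A * B⁻¹) = A * B⁻¹ * A := by
      rw [hgw, hAw, hab]
      simp only [mul_assoc, inv_mul_cancel_left]
      rw [← mul_assoc (diagPhase a b), ← mul_assoc (diagPhase l m), diagPhase_mul,
        diagPhase_mul, mul_comm a, mul_comm b]
    rw [mul_assoc, mul_right_inj] at hcomm
    refine hAB ?_
    calc A * B = B * (B⁻¹ * A) * B := by group
      _ = B * (A * B⁻¹) * B := by rw [hcomm]
      _ = B * A := by group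
  have hw00 : w.1 0 0 ≠ 0 := by
    intro e
    obtain ⟨h1, h2, h3⟩ := norm_sq_add_norm_sq w
    rw [e, norm_zero] at h1 h2
    have e11 : w.1 1 1 = 0 := by
      rw [← norm_eq_zero, ← sq_eq_zero_iff]
      linarith
    obtain ⟨a, ha⟩ := exists_circle_eq (z := w.1 0 1) (by nlinarith [norm_nonneg (w.1 0 1)])
    obtain ⟨b, hb⟩ := exists_circle_eq (z := w.1 1 0) (by nlinarith [norm_nonneg (w.1 1 0)])
    have hww : w * w = diagPhase (a * b) (a * b) := by
      apply Subtype.ext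
      ext i j
      fin_cases i <;> fin_cases j <;>
        simp [diagPhase, Matrix.mul_apply, e, e11, ha, hb, mul_comm]
    refine hA2 (a * b) ?_
    calc A * A = V * (w * w) * V⁻¹ := by rw [hAw]; group
      _ = diagPhase (a * b) (a * b) := by rw [hww, hscalar, mul_inv_cancel_right]
  have htop := eq_top_of_forall_diagPhase_mem hL
    (diagPhase_mem_of_pow_ne_pow hL hLc hLg hne) hwL hw00 hw01
  rw [eq_top_iff]
  intro u _
  have hu : V⁻¹ * u * V ∈ K.comap f := htop ▸ Subgroup.mem_top _
  rw [Subgroup.mem_comap, hf] at hu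
  simpa [mul_assoc] using hu

end UnitaryTwo

/-! ### The braid representation on the qubit -/

namespace SU2k

open Matrix UnitaryTwo

/-- The operator on the qubit `V^{τττ}_τ` with a given matrix in the basis `|0⟩`, `|1⟩`. -/
noncomputable def qubitOperator {k : ℕ} (hk : 2 ≤ k) :
    Matrix (Fin 2) (Fin 2) ℂ ≃⋆ₐ[ℂ] (ThreeAnyonSpace k 1 1 →L[ℂ] ThreeAnyonSpace k 1 1) :=
  (StarAlgEquiv.ofAlgEquiv (Matrix.reindexAlgEquiv ℂ ℂ (qubitEquiv hk)) fun M => by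
    simp [star_eq_conjTranspose]).trans Matrix.toEuclideanCLM

theorem qubitOperator_submatrix {k : ℕ} (hk : 2 ≤ k)
    (M : Matrix (InternalLabel k 1 1) (InternalLabel k 1 1) ℂ) :
    qubitOperator hk (M.submatrix (qubitEquiv hk) (qubitEquiv hk)) =
      Matrix.toEuclideanCLM (𝕜 := ℂ) M := by
  rw [qubitOperator, StarAlgEquiv.trans_apply]
  refine congrArg _ ?_
  ext i j
  change M.submatrix _ _ ((qubitEquiv hk).symm i) ((qubitEquiv hk).symm j) = M i j
  simp

/-- The identification of `U(2)` with the unitary group of the qubit given by the basis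
`|0⟩`, `|1⟩`. -/
noncomputable def qubitUnitary {k : ℕ} (hk : 2 ≤ k) :
    U2 →* unitary (ThreeAnyonSpace k 1 1 →L[ℂ] ThreeAnyonSpace k 1 1) where
  toFun u := ⟨qubitOperator hk u.1, Unitary.map_mem _ u.2⟩
  map_one' := Subtype.ext (map_one _)
  map_mul' _ _ := Subtype.ext (map_mul _ _ _)

theorem coe_qubitUnitary {k : ℕ} (hk : 2 ≤ k) (u : U2) :
    (qubitUnitary hk u : ThreeAnyonSpace k 1 1 →L[ℂ] ThreeAnyonSpace k 1 1) =
      qubitOperator hk u.1 := rfl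

theorem qubitUnitary_surjective {k : ℕ} (hk : 2 ≤ k) : Function.Surjective (qubitUnitary hk) :=
  fun v => ⟨⟨(qubitOperator hk).symm v.1, Unitary.map_mem _ v.2⟩,
    Subtype.ext ((qubitOperator hk).apply_symm_apply v.1)⟩

theorem continuous_qubitUnitary {k : ℕ} (hk : 2 ≤ k) : Continuous (qubitUnitary hk) := by
  have h : Continuous (qubitOperator hk) :=
    (qubitOperator hk).toAlgEquiv.toLinearMap.continuous_of_finiteDimensional
  exact (h.comp continuous_subtype_val).subtype_mk _

theorem qubitUnitary_diagPhase_mem_globalPhases {k : ℕ} (hk : 2 ≤ k) (c : Circle) :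
    qubitUnitary hk (diagPhase c c) ∈ globalPhases (ThreeAnyonSpace k 1 1) := by
  refine ⟨c, Circle.norm_coe c, ?_⟩
  rw [coe_qubitUnitary, show (diagPhase c c).1 = (c : ℂ) • (1 : Matrix (Fin 2) (Fin 2) ℂ) by
    ext i j
    fin_cases i <;> fin_cases j <;> simp [diagPhase], map_smul, map_one]

/-- The matrix of `ρ_k(σ₁)` in the basis `|0⟩`, `|1⟩`. -/
noncomputable def sigmaOne {k : ℕ} (hk : 2 ≤ k) : U2 :=
  ⟨(Rmat k 1 1).submatrix (qubitEquiv hk) (qubitEquiv hk), by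
    rw [mem_unitaryGroup_iff, star_eq_conjTranspose, conjTranspose_submatrix,
      submatrix_mul_equiv, ← star_eq_conjTranspose,
      mem_unitaryGroup_iff.mp (Rmat_mem_unitary k), submatrix_one_equiv]⟩

/-- The `F`-matrix in the basis `|0⟩`, `|1⟩`. -/
noncomputable def fusion {k : ℕ} (hk : 2 ≤ k) : U2 :=
  ⟨(Fmat k 1 1).submatrix (qubitEquiv hk) (qubitEquiv hk), by
    rw [mem_unitaryGroup_iff, star_eq_conjTranspose, conjTranspose_submatrix,
      submatrix_mul_equiv, ← star_eq_conjTranspose,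
      mem_unitaryGroup_iff.mp (Fmat_mem_unitary hk), submatrix_one_equiv]⟩

theorem coe_fusion {k : ℕ} (hk : 2 ≤ k) : (fusion hk).1 =
    !![-(1 / (qInt k 2 : ℂ)), (Real.sqrt (qInt k 3) : ℂ) / qInt k 2;
      (Real.sqrt (qInt k 3) : ℂ) / qInt k 2, 1 / (qInt k 2 : ℂ)] :=
  Fmat_reindex hk

theorem fusion_mul_self {k : ℕ} (hk : 2 ≤ k) : fusion hk * fusion hk = 1 := by
  apply Subtype.ext
  change _ * _ = (1 : Matrix (Fin 2) (Fin 2) ℂ)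
  rw [fusion, submatrix_mul_equiv, Fmat_mul_self hk, submatrix_one_equiv]

theorem fusion_inv {k : ℕ} (hk : 2 ≤ k) : (fusion hk)⁻¹ = fusion hk :=
  inv_eq_of_mul_eq_one_left (fusion_mul_self hk)

theorem qubitUnitary_sigmaOne {k : ℕ} (hk : 2 ≤ k) :
    qubitUnitary hk (sigmaOne hk) = qubitRep hk (braidSigma (n := 3) (0 : Fin 2)) := by
  apply Subtype.ext
  rw [qubitRep_sigma_one, coe_qubitUnitary, sigmaOne, qubitOperator_submatrix]

theorem qubitUnitary_sigmaTwo {k : ℕ} (hk : 2 ≤ k) :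
    qubitUnitary hk (fusion hk * sigmaOne hk * fusion hk) =
      qubitRep hk (braidSigma (n := 3) (1 : Fin 2)) := by
  apply Subtype.ext
  rw [qubitRep_sigma_two, coe_qubitUnitary, Fmat_inv hk, ← qubitOperator_submatrix hk]
  congr 1
  rw [← submatrix_mul_equiv _ _ _ (qubitEquiv hk), ← submatrix_mul_equiv _ _ _ (qubitEquiv hk)]
  rfl

/-- The phase `q^{1/4}` as an element of the circle. -/
noncomputable def quarterPhase (k : ℕ) : Circle :=
  ⟨qPow k (1 / 4), by simpa [Submonoid.unitSphere] using norm_qPow k (1 / 4)⟩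

theorem coe_quarterPhase (k : ℕ) : (quarterPhase k : ℂ) = qPow k (1 / 4) := rfl

theorem quarterPhase_pow_four (k : ℕ) :
    ((quarterPhase k : ℂ)) ^ 4 = Complex.exp (2 * Real.pi * Complex.I / ((k + 2 : ℕ) : ℂ)) := by
  change qPow k (1 / 4) ^ 4 = _
  rw [qPow, ← Complex.exp_nat_mul]
  congr 1
  push_cast
  ring

theorem sigmaOne_sq {k : ℕ} (hk : 2 ≤ k) :
    sigmaOne hk ^ 2 = diagPhase ((quarterPhase k)⁻¹ ^ 6) (quarterPhase k ^ 2) := by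
  apply Subtype.ext
  rw [pow_two]
  change (Rmat k 1 1).submatrix _ _ * (Rmat k 1 1).submatrix _ _ = _
  rw [Rmat_reindex hk, qPow_neg_three_quarters, ← coe_quarterPhase]
  ext i j
  fin_cases i <;> fin_cases j <;> simp [diagPhase] <;> ring

/-- For `k ≥ 3`, neither `q²` nor `q⁴` equals `1`. -/
theorem quarterPhase_pow_ne_one {k : ℕ} (hk : 3 ≤ k) {m : ℕ} (hm : m = 8 ∨ m = 16) :
    quarterPhase k ^ m ≠ 1 := by
  intro h
  have h1 : (quarterPhase k : ℂ) ^ m = 1 := by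
    rw [← Circle.coe_pow, h, Circle.coe_one]
  have hq := Complex.isPrimitiveRoot_exp (k + 2) (by omega)
  rw [← quarterPhase_pow_four] at hq
  rcases hm with rfl | rfl
  · have := Nat.le_of_dvd (by norm_num) (hq.dvd_of_pow_eq_one 2 (by rw [← pow_mul]; exact h1))
    omega
  · have := Nat.le_of_dvd (by norm_num) (hq.dvd_of_pow_eq_one 4 (by rw [← pow_mul]; exact h1))
    omega

/-- The matrices `A` of `ρ_k(σ₁²)` and `F A F` of `ρ_k(σ₂²)` do not commute, as `A` has distinct
eigenvalues and `F A F` is not diagonal. -/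
theorem sigma_sq_not_commute {k : ℕ} (hk : 3 ≤ k) (hk2 : 2 ≤ k) :
    sigmaOne hk2 ^ 2 * (fusion hk2 * sigmaOne hk2 ^ 2 * fusion hk2) ≠
      fusion hk2 * sigmaOne hk2 ^ 2 * fusion hk2 * sigmaOne hk2 ^ 2 := by
  intro h
  obtain ⟨h2, h2'⟩ := two_le_qInt_two_sq hk2
  have h3 : 0 < qInt k 3 := by rw [qInt_three]; linarith
  have hd : (qInt k 2 : ℂ) ≠ 0 := by exact_mod_cast h2.ne'
  have hu : (Real.sqrt (qInt k 3) : ℂ) ≠ 0 := by exact_mod_cast (Real.sqrt_pos.mpr h3).ne'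
  have e := congrFun (congrFun (congrArg (fun u : U2 => u.1) h) 0) 1
  simp only [sigmaOne_sq, Submonoid.coe_mul, coe_fusion, diagPhase] at e
  simp [Matrix.mul_apply] at e
  field_simp at e
  refine quarterPhase_pow_ne_one hk (m := 8) (Or.inl rfl) (Circle.ext ?_)
  push_cast
  generalize (quarterPhase k : ℂ) = p at *
  have h8 : (p ^ 8 - 1) ^ 2 = 0 := by linear_combination -e
  exact sub_eq_zero.mp (pow_eq_zero_iff two_ne_zero |>.mp h8)

theorem fusion_conj_inv {k : ℕ} (hk : 2 ≤ k) (u : U2) :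
    (fusion hk * u * fusion hk)⁻¹ = fusion hk * u⁻¹ * fusion hk := by
  rw [_root_.mul_inv_rev, _root_.mul_inv_rev, fusion_inv, mul_assoc]

/-- The trace of `ρ_k(σ₁² σ₂⁻²)` is `t² - t` with `t = q + q⁻¹`. -/
theorem trace_sigma_sq {k : ℕ} (hk : 2 ≤ k) :
    (sigmaOne hk ^ 2 * (fusion hk * sigmaOne hk ^ 2 * fusion hk)⁻¹).1.trace =
      ((quarterPhase k : ℂ) ^ 4 + ((quarterPhase k : ℂ) ^ 4)⁻¹) ^ 2 -
        ((quarterPhase k : ℂ) ^ 4 + ((quarterPhase k : ℂ) ^ 4)⁻¹) := by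
  obtain ⟨h2, h2'⟩ := two_le_qInt_two_sq hk
  have h3 : 0 ≤ qInt k 3 := by rw [qInt_three]; linarith
  have hu : (Real.sqrt (qInt k 3) : ℂ) ^ 2 = (qInt k 2 : ℂ) ^ 2 - 1 := by
    rw [← Complex.ofReal_pow, Real.sq_sqrt h3, qInt_three]
    push_cast
    rfl
  have hd : (qInt k 2 : ℂ) ≠ 0 := by exact_mod_cast h2.ne'
  have hdp : (qInt k 2 : ℂ) = (quarterPhase k : ℂ) ^ 2 + (quarterPhase k : ℂ)⁻¹ ^ 2 :=
    qInt_two_eq k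
  have hinv : (diagPhase ((quarterPhase k)⁻¹ ^ 6) (quarterPhase k ^ 2))⁻¹ =
      diagPhase (quarterPhase k ^ 6) ((quarterPhase k)⁻¹ ^ 2) := by
    rw [inv_eq_iff_mul_eq_one, diagPhase_mul, ← mul_pow, ← mul_pow, inv_mul_cancel,
      mul_inv_cancel, one_pow, one_pow, diagPhase_one]
  rw [fusion_conj_inv, sigmaOne_sq, hinv]
  simp only [Submonoid.coe_mul, coe_fusion, diagPhase]
  simp [Matrix.trace_fin_two]
  have hp := (quarterPhase k).coe_ne_zero
  generalize (quarterPhase k : ℂ) = p at *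
  generalize (Real.sqrt (qInt k 3) : ℂ) = u at *
  generalize (qInt k 2 : ℂ) = d at *
  have hD : d ^ 2 * p ^ 4 = (p ^ 4 + 1) ^ 2 := by
    rw [hdp]
    field_simp
  field_simp
  refine mul_left_cancel₀ (pow_ne_zero 4 hp) ?_
  linear_combination p ^ 4 * (1 + p ^ 16) * hu +
    (1 + p ^ 16 - (p ^ 8 + 1) * (p ^ 8 + 1 - p ^ 4)) * hD

theorem det_sigma_sq {k : ℕ} (hk : 2 ≤ k) :
    (sigmaOne hk ^ 2 * (fusion hk * sigmaOne hk ^ 2 * fusion hk)⁻¹).1.det = 1 := by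
  rw [fusion_conj_inv]
  have h1 : (fusion hk).1.det * (fusion hk).1.det = 1 := by
    rw [← Matrix.det_mul, ← Submonoid.coe_mul, fusion_mul_self]
    exact Matrix.det_one
  have h2 : (sigmaOne hk ^ 2).1.det * ((sigmaOne hk ^ 2)⁻¹).1.det = 1 := by
    rw [← Matrix.det_mul, ← Submonoid.coe_mul, mul_inv_cancel]
    exact Matrix.det_one
  rw [Submonoid.coe_mul, Submonoid.coe_mul, Submonoid.coe_mul, Matrix.det_mul, Matrix.det_mul,
    Matrix.det_mul]
  linear_combination (sigmaOne hk ^ 2).1.det * ((sigmaOne hk ^ 2)⁻¹).1.det * h1 + h2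

/-- A closed subgroup of `U(2)` containing the scalars, `ρ_k(σ₁²)` and `ρ_k(σ₂²)` is `U(2)`. -/
theorem eq_top_of_sigma_sq_mem {k : ℕ} (hk : 3 ≤ k) (hk4 : k ≠ 4) (hk8 : k ≠ 8) (hk2 : 2 ≤ k)
    {K : Subgroup U2} (hK : IsClosed (K : Set U2)) (hc : ∀ c : Circle, diagPhase c c ∈ K)
    (h1 : sigmaOne hk2 ^ 2 ∈ K) (h2 : fusion hk2 * sigmaOne hk2 ^ 2 * fusion hk2 ∈ K) : K = ⊤ := by
  refine eq_top_of_mem_of_mem hK hc h1 h2 (sigma_sq_not_commute hk hk2) ?_ (det_sigma_sq hk2) ?_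
  -- If the square of `diag (q^{-3/2}, q^{1/2})` were a scalar, then `q⁴ = 1`.
  · intro c h
    rw [sigmaOne_sq, diagPhase_mul] at h
    have e := congrArg (fun u : U2 => u.1) h
    have e0 : (quarterPhase k)⁻¹ ^ 6 * (quarterPhase k)⁻¹ ^ 6 = c :=
      Circle.ext (by simpa [diagPhase] using congrFun (congrFun e 0) 0)
    have e1 : quarterPhase k ^ 2 * quarterPhase k ^ 2 = c :=
      Circle.ext (by simpa [diagPhase] using congrFun (congrFun e 1) 1)
    refine quarterPhase_pow_ne_one hk (m := 16) (Or.inr rfl) ?_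
    have : quarterPhase k ^ 16 = (quarterPhase k ^ 2 * quarterPhase k ^ 2) *
        ((quarterPhase k)⁻¹ ^ 6 * (quarterPhase k)⁻¹ ^ 6)⁻¹ := by group
    rw [this, e0, e1, mul_inv_cancel]
  · intro z n hn hz
    rw [trace_sigma_sq hk2]
    exact trace_ne_add_inv_of_pow_eq_one (n := k + 2) (by omega) (by omega) (by omega)
      (quarterPhase_pow_four k) hn hz

/-- Universality of every set of gates that contains the two elementary double-braidings. The
closure is taken in `U(2)` and the dense subgroup obtained there is carried to the operators. -/
theorem dense_closure_of_sigma_sq_mem {k : ℕ} (hk : 3 ≤ k) (hk4 : k ≠ 4) (hk8 : k ≠ 8)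
    (hk2 : 2 ≤ k) {S : Set (unitary (ThreeAnyonSpace k 1 1 →L[ℂ] ThreeAnyonSpace k 1 1))}
    (h1 : qubitRep hk2 (braidSigma (n := 3) (0 : Fin 2) ^ 2) ∈ S)
    (h2 : qubitRep hk2 (braidSigma (n := 3) (1 : Fin 2) ^ 2) ∈ S) :
    Dense ((Subgroup.closure (S ∪ globalPhases (ThreeAnyonSpace k 1 1)) :
        Subgroup (unitary (ThreeAnyonSpace k 1 1 →L[ℂ] ThreeAnyonSpace k 1 1))) :
      Set (unitary (ThreeAnyonSpace k 1 1 →L[ℂ] ThreeAnyonSpace k 1 1))) := by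
  set H := Subgroup.closure (S ∪ globalPhases (ThreeAnyonSpace k 1 1))
  have hsub : S ∪ globalPhases (ThreeAnyonSpace k 1 1) ⊆ H := Subgroup.subset_closure
  set L : Subgroup U2 := H.comap (qubitUnitary hk2)
  have hle : L ≤ L.topologicalClosure := L.le_topologicalClosure
  have htop : L.topologicalClosure = ⊤ := by
    refine eq_top_of_sigma_sq_mem hk hk4 hk8 hk2 L.isClosed_topologicalClosure
      (fun c => hle (hsub (Or.inr (qubitUnitary_diagPhase_mem_globalPhases hk2 c))))
      (hle ?_) (hle ?_)
    · rw [Subgroup.mem_comap, map_pow, qubitUnitary_sigmaOne, ← map_pow]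
      exact hsub (Or.inl h1)
    · have e : fusion hk2 * sigmaOne hk2 ^ 2 * fusion hk2 =
          (fusion hk2 * sigmaOne hk2 * fusion hk2) ^ 2 := by
        have := conj_pow (i := 2) (a := fusion hk2) (b := sigmaOne hk2)
        rw [fusion_inv] at this
        exact this.symm
      rw [Subgroup.mem_comap, e, map_pow, qubitUnitary_sigmaTwo, ← map_pow]
      exact hsub (Or.inl h2)
  have hdense : Dense (L : Set U2) := by
    rw [dense_iff_closure_eq, ← Subgroup.topologicalClosure_coe, htop, Subgroup.coe_top]
  refine ((qubitUnitary_surjective hk2).denseRange.dense_image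
    (continuous_qubitUnitary hk2) hdense).mono ?_
  rintro _ ⟨u, hu, rfl⟩
  exact hu

end SU2k

theorem mainTheorem1 (k : ℕ) (hk : 3 ≤ k) (hk4 : k ≠ 4) (hk8 : k ≠ 8) :
    Dense ((Subgroup.closure
        ({SU2k.qubitRep (Nat.le_of_succ_le hk) (braidSigma (n := 3) (0 : Fin 2) ^ 2),
            SU2k.qubitRep (Nat.le_of_succ_le hk) (braidSigma (n := 3) (1 : Fin 2) ^ 2)} ∪
          globalPhases (SU2k.ThreeAnyonSpace k 1 1)) :
        Subgroup (unitary (SU2k.ThreeAnyonSpace k 1 1 →L[ℂ] SU2k.ThreeAnyonSpace k 1 1))) :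
      Set (unitary (SU2k.ThreeAnyonSpace k 1 1 →L[ℂ] SU2k.ThreeAnyonSpace k 1 1))) ∧
    IsUniversalGateSet (SU2k.qubitRep (Nat.le_of_succ_le hk) '' (doubleBraidings 3)) := by
  refine ⟨SU2k.dense_closure_of_sigma_sq_mem hk hk4 hk8 _ (Or.inl rfl) (Or.inr rfl), ?_⟩
  have hmem : ∀ i : Fin 2, braidSigma (n := 3) i ^ 2 ∈ doubleBraidings 3 :=
    fun i => Subgroup.subset_closure ⟨i, rfl⟩
  exact SU2k.dense_closure_of_sigma_sq_mem hk hk4 hk8 _ ⟨_, hmem 0, rfl⟩ ⟨_, hmem 1, rfl⟩
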